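/- For a probability distribution $p$ on $\mathbb{R}$ with finite mean $\mu_p$ and without atoms, and for $t\in(0,1)$, the $t$-trimming of $p$ is $p$ conditioned on an interval $[\mu_p-r,\mu_p+r]$ of $p$-mass exactly $1-t$ (such an $r$ exists, and the conditioned distribution does not depend on its choice). For real $n>0$ and $\delta\in(0,1)$ with $\frac{0.45}{n}\log\frac1\delta<1$, let $p^*_{n}$ be the $\frac{0.45}{n}\log\frac1\delta$-trimming of $p$, and let $$\epsilon_{n,\delta}(p)=|\mu_p-\mu_{p^*_n}|+\sigma_{p^*_n}\sqrt{\frac{4.5\log\frac1\delta}{n}},$$ where $\mu$ and $\sigma$ denote mean and standard deviation. Let $d_H^2(p,q)=\frac12\int(\sqrt{dp}-\sqrt{dq})^2$ be the squared Hellinger distance. Let $N_{n,\delta}(p)$ be the set of all probability distributions $q$ on $\mathbb{R}$ with finite mean such that 1. $\epsilon_{n/3,\delta}(q)\le 100\,\epsilon_{n,\delta}(p)$, 2. $\log(1-d_H^2(p,q))\ge\frac{1}{2n}\log(4\delta)$, 3. $|\mu_q-\mu_p|\le\epsilon_{n,\delta}(p)$, 4. $q$ is absolutely continuous with respect to $p$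 and $\frac{dq}{dp}\le 2$. **Lemma.** There is an absolute constant $c>0$ such that the following holds for every integer $n\ge1$ and every $\delta>0$ with $\delta\le c$ and $\frac{\log(1/\delta)}{n}\le c$. For every probability distribution $p$ on $\mathbb{R}$ with finite mean and without atoms there is a distribution $q\ne p$ such that $$|\mu_q-\mu_p|\ge\tfrac{1}{32}\,\epsilon_{n,\delta}(p),\qquad \log(1-d_H^2(p,q))\ge\tfrac{1}{2n}\log(4\delta),\qquad q\in N_{n,\delta}(p).$$ -/

import Mathlib

namespace MeanEst

open MeasureTheory Filter Topology

noncomputable section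

/-- The mean of a distribution on the real line. -/
def mean (p : Measure ℝ) : ℝ := ∫ x, x ∂p

/-- The standard deviation of a distribution on the real line. -/
def stdDev (p : Measure ℝ) : ℝ := Real.sqrt (ProbabilityTheory.variance id p)

/-- All probability distributions on the real line with a finite first moment. -/
def FiniteMeanDist : Set (Measure ℝ) :=
  {p | IsProbabilityMeasure p ∧ Integrable (fun x : ℝ => x) p}

/-- The closed interval of radius `r` around the mean of `p`. -/
def centered (p : Measure ℝ) (r : ℝ) : Set ℝ := Set.Icc (mean p - r) (mean p + r)

/-- `r` is a radius for the `t`-trimming of `p`: the interval of radius `r` around the mean of `p`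
has mass exactly `1 - t`. -/
def IsTrimRadius (p : Measure ℝ) (t r : ℝ) : Prop :=
  0 ≤ r ∧ p.real (centered p r) = 1 - t

/-- A trimming radius. It exists for atomless distributions (`isTrimRadius_trimRadius`), and the
trimmed distribution does not depend on which one is selected (`trim_eq`). -/
def trimRadius (p : Measure ℝ) (t : ℝ) : ℝ := Classical.epsilon (IsTrimRadius p t)

/-- The `t`-trimming of `p`: the distribution `p` conditioned on lying in the interval around its
mean that has mass `1 - t`. -/
def trim (p : Measure ℝ) (t : ℝ) : Measure ℝ :=
  ProbabilityTheory.cond p (centered p (trimRadius p t))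

/-- The standard trimmed distribution: the `(0.45 / n) log (1 / δ)`-trimming of `p`. The parameter
`n` is real, since the error function is also used at one third of the sample size. -/
def stdTrim (n δ : ℝ) (p : Measure ℝ) : Measure ℝ :=
  trim p (0.45 / n * Real.log (1 / δ))

/-- The error function `|μ_p - μ_{p*}| + σ_{p*} √(4.5 log (1 / δ) / n)`, with `p*` the standard
trimmed version of `p`. -/
def errorFn (n δ : ℝ) (p : Measure ℝ) : ℝ :=
  |mean p - mean (stdTrim n δ p)| +
    stdDev (stdTrim n δ p) * Real.sqrt (4.5 * Real.log (1 / δ) / n)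

/-- The squared Hellinger distance `(1 / 2) ∫ (√dp - √dq)²`, written with densities with respect to
the dominating measure `p + q`. -/
def hellingerSq (p q : Measure ℝ) : ℝ :=
  1 / 2 * ∫ x, (Real.sqrt (p.rnDeriv (p + q) x).toReal
    - Real.sqrt (q.rnDeriv (p + q) x).toReal) ^ 2 ∂(p + q)

/-- The bound `log (1 - d_H²(p, q)) ≥ (1 / (2 n)) log (4 δ)`. The first conjunct says that the
logarithm on the left is a genuine one (it would be `-∞` at squared distance `1`). -/
def HellingerClose (n δ : ℝ) (p q : Measure ℝ) : Prop :=
  hellingerSq p q < 1 ∧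
    1 / (2 * n) * Real.log (4 * δ) ≤ Real.log (1 - hellingerSq p q)

/-- `dq/dp ≤ 2`: `q` has a density with respect to `p`, and it is at most `2`. -/
def DensityLeTwo (p q : Measure ℝ) : Prop :=
  q ≪ p ∧ ∀ᵐ x ∂p, q.rnDeriv p x ≤ 2

/-- The neighborhood of `p`. -/
def nbhd (n δ : ℝ) (p : Measure ℝ) : Set (Measure ℝ) :=
  {q | q ∈ FiniteMeanDist ∧
    errorFn (n / 3) δ q ≤ 100 * errorFn n δ p ∧
    HellingerClose n δ p q ∧
    |mean q - mean p| ≤ errorFn n δ p ∧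
    DensityLeTwo p q}

theorem exists_isTrimRadius (p : Measure ℝ) [IsProbabilityMeasure p] [NullSingletonClass p]
    {t : ℝ} (h0 : 0 < t) (h1 : t ≤ 1) : ∃ r, IsTrimRadius p t r := by
  have hmeas : Measurable fun x : ℝ => |x - mean p| := by fun_prop
  let ν : Measure ℝ := p.map fun x => |x - mean p|
  have : IsProbabilityMeasure ν := Measure.isProbabilityMeasure_map hmeas.aemeasurable
  have hpre : ∀ r : ℝ, (fun x : ℝ => |x - mean p|) ⁻¹' Set.Iic r = centered p r := by
    intro r
    ext x
    simp only [centered, Set.mem_preimage, Set.mem_Iic, Set.mem_Icc, abs_le]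
    constructor <;> rintro ⟨h, h'⟩ <;> constructor <;> linarith
  have hF : ∀ r, ProbabilityTheory.cdf ν r = p.real (centered p r) := by
    intro r
    rw [ProbabilityTheory.cdf_eq_real, Measure.real, Measure.map_apply hmeas measurableSet_Iic,
      hpre, Measure.real]
  have hat : NullSingletonClass ν := by
    refine ⟨fun y => ?_⟩
    rw [Measure.map_apply hmeas (measurableSet_singleton y)]
    refine Set.Finite.measure_zero (Set.Finite.subset
      (Set.toFinite {mean p + y, mean p - y}) ?_) p
    intro x hx
    simp only [Set.mem_preimage, Set.mem_singleton_iff] at hx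
    simp only [Set.mem_insert_iff, Set.mem_singleton_iff]
    rcases abs_choice (x - mean p) with h | h
    · left; linarith
    · right; linarith
  have hcont : Continuous (ProbabilityTheory.cdf ν) := by
    rw [continuous_iff_continuousAt]
    intro x
    have hs := StieltjesFunction.measure_singleton (ProbabilityTheory.cdf ν) x
    rw [ProbabilityTheory.measure_cdf, measure_singleton, eq_comm, ENNReal.ofReal_eq_zero] at hs
    have hm := (ProbabilityTheory.cdf ν).mono
    have hl : Function.leftLim (ProbabilityTheory.cdf ν) x = ProbabilityTheory.cdf ν x :=
      le_antisymm (hm.leftLim_le le_rfl) (by linarith)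
    rw [hm.continuousAt_iff_leftLim_eq_rightLim, hl, (ProbabilityTheory.cdf ν).rightLim_eq]
  have hzero : ProbabilityTheory.cdf ν 0 = 0 := by
    rw [hF]
    simp [centered, Measure.real]
  rcases h1.lt_or_eq with h1 | h1
  · have hlim := ProbabilityTheory.tendsto_cdf_atTop ν
    have hev := hlim.eventually (lt_mem_nhds (show 1 - t < 1 by linarith))
    obtain ⟨R, hR, hR0⟩ := (hev.and (eventually_ge_atTop 0)).exists
    obtain ⟨r, hr, hr'⟩ := intermediate_value_Icc hR0 hcont.continuousOn
      (show 1 - t ∈ Set.Icc _ _ by rw [hzero]; exact ⟨by linarith, hR.le⟩)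
    exact ⟨r, hr.1, by rw [← hF, hr']⟩
  · exact ⟨0, le_rfl, by rw [← hF, hzero, h1]; ring⟩

theorem isTrimRadius_trimRadius (p : Measure ℝ) [IsProbabilityMeasure p] [NullSingletonClass p]
    {t : ℝ} (h0 : 0 < t) (h1 : t ≤ 1) : IsTrimRadius p t (trimRadius p t) :=
  Classical.epsilon_spec (exists_isTrimRadius p h0 h1)

theorem trim_eq (p : Measure ℝ) [IsProbabilityMeasure p] {t r : ℝ}
    (hr : IsTrimRadius p t r) : trim p t = ProbabilityTheory.cond p (centered p r) := by
  have key : ∀ a b : ℝ, a ≤ b → p.real (centered p a) = p.real (centered p b) →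
      ProbabilityTheory.cond p (centered p a) = ProbabilityTheory.cond p (centered p b) := by
    intro a b hab h
    have hsub : centered p a ⊆ centered p b := Set.Icc_subset_Icc (by linarith) (by linarith)
    have hm : p (centered p a) = p (centered p b) := by
      rwa [Measure.real, Measure.real,
        ENNReal.toReal_eq_toReal_iff' (measure_ne_top _ _) (measure_ne_top _ _)] at h
    have hae : centered p a =ᵐ[p] centered p b :=
      ae_eq_of_subset_of_measure_ge hsub hm.ge measurableSet_Icc.nullMeasurableSet
        (measure_ne_top _ _)
    simp only [ProbabilityTheory.cond]
    rw [hm, Measure.restrict_congr_set hae]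
  have hs : IsTrimRadius p t (trimRadius p t) := Classical.epsilon_spec ⟨r, hr⟩
  have he : p.real (centered p (trimRadius p t)) = p.real (centered p r) := by
    rw [hs.2, hr.2]
  rcases le_total (trimRadius p t) r with h | h
  · exact key _ _ h he
  · exact (key _ _ h he.symm).symm

end

end MeanEst

/-!
Write `t = 0.45 log (1 / δ) / n`, let `μ` be the mean of `p`, and let `J` be the interval around `μ`
of mass `1 - t` defining the trimmed distribution, with mean `μ + b` and standard deviation `σ`. The
error of `p` is then `ε = |b| + σ √(10 t)`. The distribution `q` is sought in the form `(1 + h) p`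
with `|h| ≤ 1`, `∫ h dp = 0` and `∫ h² dp ≤ 1.3 t`. Such a `q` has density at most `2`, and its
squared Hellinger distance from `p` is at most `½ ∫ h² dp`, which for small `δ` and `t` is within
the allowed range (`IsTilt.hellingerClose`).

*Moving the mean* (`exists_isTilt_mean_shift`). It is enough to find `f` of oscillation at most one
with `∫ f² dp ≤ 1.3 t` and `|∫ (x - μ) f dp| ≥ ε / 32`, since centering and rescaling `f` yields an
`h` that moves the mean by exactly `ε / 32`. If `|b| ≥ ε / 31`, the indicator of the complement of
`J` does this, because the mass outside `J` compensates the shift of the mean on `J`. Otherwise `ε`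
is comparable to `σ √t`, and `f` is `√t (x - μ) / σ` clipped to `[-1/2, 1/2]`. Here the integrand
`(x - μ) f` is nonnegative, and if clipping already occurs on `J` then the mass `t` outside `J`,
which is at distance at least `σ / (2 √t)`, contributes enough by itself.

*The error of `q`* (`IsTilt.trimError_le`). Replacing `n` by `n / 3` trims at level `3 t`. Let `I` be
the corresponding interval around the mean of `q`. Since `q` has mass `3 t` outside `I`, `p` has mass
at least `1.5 t` there, hence mass at least `t / 2` in `J \ I`; so the radius of `I` is bounded by
`√(2 S / t)`, up to the distance between the means, where `S` is the second moment of `p` over `J`.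
Outside `J` the distribution `q` has mass at most `2 t`, so this part of `I` contributes `O(√(t S))`
to the first moment and `O(S)` to the second. On `J` the perturbation is controlled in `L²`, so it
changes the first moment by `O(√(t S))` as well. As `√(t S)` is at most of the order of `ε`, this
bounds the error of `q` by a multiple of `ε`.
-/

namespace MeanEst

open MeasureTheory ProbabilityTheory

noncomputable section

/-! ### Moments of conditioned distributions -/

theorem integral_cond_eq (p : Measure ℝ) (A : Set ℝ) (f : ℝ → ℝ) :
    ∫ x, f x ∂(cond p A) = (p.real A)⁻¹ * ∫ x in A, f x ∂p := by
  rw [ProbabilityTheory.cond, integral_smul_measure, ENNReal.toReal_inv, Measure.real, smul_eq_mul]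

theorem integrable_cond_Icc (p : Measure ℝ) [IsFiniteMeasure p] {a b : ℝ}
    (h : 0 < p.real (Set.Icc a b)) {f : ℝ → ℝ} (hf : Continuous f) :
    Integrable f (cond p (Set.Icc a b)) := by
  have h0 : p (Set.Icc a b) ≠ 0 := fun h0 => by simp [Measure.real, h0] at h
  exact (hf.integrableOn_Icc).integrable.smul_measure (ENNReal.inv_ne_top.2 h0)

theorem mean_cond_sub (p : Measure ℝ) [IsFiniteMeasure p] {a b : ℝ}
    (h : 0 < p.real (Set.Icc a b)) (c : ℝ) :
    mean (cond p (Set.Icc a b)) - c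
      = (p.real (Set.Icc a b))⁻¹ * ∫ x in Set.Icc a b, (x - c) ∂p := by
  have h0 : p (Set.Icc a b) ≠ 0 := fun h0 => by simp [Measure.real, h0] at h
  have := cond_isProbabilityMeasure h0
  rw [← integral_cond_eq, integral_sub (integrable_cond_Icc p h (f := fun x => x) continuous_id)
    (integrable_const c), integral_const]
  simp [mean]

/-- The variance of a distribution conditioned on an interval, from its second moment about an
arbitrary centre. -/
theorem variance_cond_eq (p : Measure ℝ) [IsFiniteMeasure p] {a b : ℝ}
    (h : 0 < p.real (Set.Icc a b)) (c : ℝ) :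
    Var[id; cond p (Set.Icc a b)]
      = (p.real (Set.Icc a b))⁻¹ * (∫ x in Set.Icc a b, (x - c) ^ 2 ∂p)
        - (mean (cond p (Set.Icc a b)) - c) ^ 2 := by
  have h0 : p (Set.Icc a b) ≠ 0 := fun h0 => by simp [Measure.real, h0] at h
  have := cond_isProbabilityMeasure h0
  have hv : Var[fun x : ℝ => id x - c; cond p (Set.Icc a b)] = Var[id; cond p (Set.Icc a b)] :=
    variance_sub_const (by fun_prop) c
  have hm : MemLp (fun x : ℝ => id x - c) 2 (cond p (Set.Icc a b)) := by
    rw [memLp_two_iff_integrable_sq (by fun_prop)]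
    exact integrable_cond_Icc p h (by fun_prop)
  rw [← hv, variance_eq_sub hm, ← integral_cond_eq, mean_cond_sub p h, ← integral_cond_eq]
  rfl

theorem variance_cond_pos (p : Measure ℝ) [IsFiniteMeasure p] [NullSingletonClass p] {a b : ℝ}
    (h : 0 < p.real (Set.Icc a b)) : 0 < Var[id; cond p (Set.Icc a b)] := by
  have h0 : p (Set.Icc a b) ≠ 0 := fun h0 => by simp [Measure.real, h0] at h
  have := cond_isProbabilityMeasure h0
  have hm : MemLp (id : ℝ → ℝ) 2 (cond p (Set.Icc a b)) := by
    rw [memLp_two_iff_integrable_sq (by fun_prop)]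
    exact integrable_cond_Icc p h (by fun_prop)
  refine lt_of_le_of_ne (variance_nonneg _ _) fun h1 => ?_
  have h2 := ae_eq_integral_of_variance_eq_zero hm h1.symm
  set m := ∫ x, id x ∂(cond p (Set.Icc a b))
  have h3 : cond p (Set.Icc a b) {m} = 0 :=
    cond_absolutelyContinuous (measure_singleton (μ := p) m)
  have h4 : ∀ᵐ x ∂(cond p (Set.Icc a b)), x ≠ m := by
    rw [ae_iff]; simpa using h3
  obtain ⟨x, hx, hx'⟩ := (h2.and h4).exists
  exact hx' hx

/-! ### Bounded tilts of a distribution -/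

/-- The measure with density `1 + h` with respect to `p`. -/
def tilt (p : Measure ℝ) (h : ℝ → ℝ) : Measure ℝ := p.withDensity fun x => ENNReal.ofReal (1 + h x)

/-- `h` is an admissible perturbation of `p`: measurable, with values in `[-1, 1]` and mean zero,
so that `1 + h` is a probability density with values in `[0, 2]`. -/
structure IsTilt (p : Measure ℝ) (h : ℝ → ℝ) : Prop where
  measurable : Measurable h
  abs_le_one : ∀ x, |h x| ≤ 1
  integral_eq_zero : ∫ x, h x ∂p = 0

namespace IsTilt

variable {p : Measure ℝ} {h : ℝ → ℝ}

theorem nonneg (H : IsTilt p h) (x : ℝ) : 0 ≤ 1 + h x := by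
  have := (abs_le.1 (H.abs_le_one x)).1; linarith

theorem le_two (H : IsTilt p h) (x : ℝ) : 1 + h x ≤ 2 := by
  have := (abs_le.1 (H.abs_le_one x)).2; linarith

theorem integrable_mul (H : IsTilt p h) {f : ℝ → ℝ} (hf : Integrable f p) :
    Integrable (fun x => h x * f x) p :=
  hf.bdd_mul (c := 1) H.measurable.aestronglyMeasurable
    (ae_of_all _ fun x => by simpa using H.abs_le_one x)

theorem integrable [IsFiniteMeasure p] (H : IsTilt p h) : Integrable h p := by
  simpa using H.integrable_mul (integrable_const (1 : ℝ))

theorem integrable_sq [IsFiniteMeasure p] (H : IsTilt p h) : Integrable (fun x => h x ^ 2) p := by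
  simpa [sq] using H.integrable_mul H.integrable

theorem measurable_density (H : IsTilt p h) :
    Measurable fun x => ENNReal.ofReal (1 + h x) :=
  (H.measurable.const_add 1).ennreal_ofReal

theorem integral_tilt (H : IsTilt p h) (f : ℝ → ℝ) :
    ∫ x, f x ∂(tilt p h) = ∫ x, (1 + h x) * f x ∂p := by
  rw [tilt, integral_withDensity_eq_integral_toReal_smul H.measurable_density
    (ae_of_all _ fun _ => ENNReal.ofReal_lt_top)]
  simp [ENNReal.toReal_ofReal (H.nonneg _)]

theorem integrable_tilt (H : IsTilt p h) {f : ℝ → ℝ} (hf : Integrable f p) :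
    Integrable f (tilt p h) := by
  rw [tilt, integrable_withDensity_iff_integrable_smul' H.measurable_density
    (ae_of_all _ fun _ => ENNReal.ofReal_lt_top)]
  simp only [ENNReal.toReal_ofReal (H.nonneg _), smul_eq_mul, add_mul, one_mul]
  exact hf.add (H.integrable_mul hf)

theorem setIntegral_tilt (H : IsTilt p h) {A : Set ℝ} (hA : MeasurableSet A) (f : ℝ → ℝ) :
    ∫ x in A, f x ∂(tilt p h) = ∫ x in A, (1 + h x) * f x ∂p := by
  rw [← integral_indicator hA, H.integral_tilt, ← integral_indicator hA]
  congr 1 with x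
  by_cases hx : x ∈ A <;> simp [hx]

theorem measureReal_tilt (H : IsTilt p h) {A : Set ℝ} (hA : MeasurableSet A) :
    (tilt p h).real A = ∫ x in A, (1 + h x) ∂p := by
  have := H.setIntegral_tilt hA fun _ => 1
  simpa using this

theorem isProbabilityMeasure_tilt [IsProbabilityMeasure p] (H : IsTilt p h) :
    IsProbabilityMeasure (tilt p h) := by
  constructor
  have hi : Integrable (fun x => 1 + h x) p := (integrable_const 1).add H.integrable
  rw [tilt, withDensity_apply _ MeasurableSet.univ, Measure.restrict_univ,
    ← ofReal_integral_eq_lintegral_ofReal hi (ae_of_all _ H.nonneg),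
    integral_add (integrable_const 1) H.integrable, H.integral_eq_zero]
  simp

theorem tilt_absolutelyContinuous : tilt p h ≪ p := withDensity_absolutelyContinuous _ _

theorem mean_tilt_sub [IsProbabilityMeasure p] (H : IsTilt p h)
    (hp : Integrable (fun x : ℝ => x) p) :
    mean (tilt p h) - mean p = ∫ x, h x * x ∂p := by
  have := H.integral_tilt fun x => x
  simp only [add_mul, one_mul] at this
  rw [integral_add hp (H.integrable_mul hp)] at this
  simp only [mean, this]
  ring

theorem rnDeriv_tilt [IsFiniteMeasure p] (H : IsTilt p h) :
    (tilt p h).rnDeriv p =ᵐ[p] fun x => ENNReal.ofReal (1 + h x) :=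
  Measure.rnDeriv_withDensity p H.measurable_density

theorem densityLeTwo_tilt [IsFiniteMeasure p] (H : IsTilt p h) : DensityLeTwo p (tilt p h) := by
  refine ⟨tilt_absolutelyContinuous, ?_⟩
  filter_upwards [H.rnDeriv_tilt] with x hx
  rw [hx]
  exact (ENNReal.ofReal_le_ofReal (H.le_two x)).trans (by simp)

theorem hellingerSq_tilt [IsProbabilityMeasure p] (H : IsTilt p h) :
    hellingerSq p (tilt p h) = 1 / 2 * ∫ x, (1 - √(1 + h x)) ^ 2 ∂p := by
  have := H.isProbabilityMeasure_tilt
  have hp : p ≪ p + tilt p h := Measure.AbsolutelyContinuous.rfl.add_right _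
  have hνp : p + tilt p h ≪ p :=
    Measure.AbsolutelyContinuous.rfl.add_left tilt_absolutelyContinuous
  have h1 := Measure.rnDeriv_mul_rnDeriv (κ := p + tilt p h)
    (tilt_absolutelyContinuous (p := p) (h := h))
  have h2 := hνp.ae_eq H.rnDeriv_tilt
  rw [hellingerSq, ← integral_rnDeriv_smul hp]
  congr 1
  refine integral_congr_ae ?_
  filter_upwards [h1, h2] with x hx hx'
  rw [← hx, Pi.mul_apply, hx', ENNReal.toReal_mul, ENNReal.toReal_ofReal (H.nonneg x),
    Real.sqrt_mul (H.nonneg x), smul_eq_mul]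
  have := Real.sq_sqrt (ENNReal.toReal_nonneg (a := p.rnDeriv (p + tilt p h) x))
  linear_combination (1 - √(1 + h x)) ^ 2 * this

/-- The squared Hellinger distance is at most half of the `χ²`-divergence. -/
theorem hellingerSq_tilt_le [IsProbabilityMeasure p] (H : IsTilt p h) :
    hellingerSq p (tilt p h) ≤ 1 / 2 * ∫ x, h x ^ 2 ∂p := by
  rw [H.hellingerSq_tilt]
  refine mul_le_mul_of_nonneg_left (integral_mono_of_nonneg (ae_of_all _ fun x => sq_nonneg _)
    H.integrable_sq (ae_of_all _ fun x => ?_)) (by norm_num)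
  have h1 := Real.sq_sqrt (H.nonneg x)
  have h2 := Real.sqrt_nonneg (1 + h x)
  have h3 : h x = (√(1 + h x) - 1) * (√(1 + h x) + 1) := by linear_combination -h1
  calc (1 - √(1 + h x)) ^ 2 ≤ (1 - √(1 + h x)) ^ 2 * (√(1 + h x) + 1) ^ 2 :=
        le_mul_of_one_le_right (sq_nonneg _) (by nlinarith)
    _ = h x ^ 2 := by nth_rewrite 3 [h3]; ring

end IsTilt

/-- A tilt of `χ²`-divergence at most `0.585 log (1 / δ) / n` is Hellinger-close, once the term
`log 4` is negligible against `log (1 / δ)`. -/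
theorem IsTilt.hellingerClose {p : Measure ℝ} [IsProbabilityMeasure p] {h : ℝ → ℝ}
    (H : IsTilt p h) {n δ : ℝ} (hn : 0 < n) (hδ : 0 < δ) (hL : 100 ≤ Real.log (1 / δ))
    (hs : Real.log (1 / δ) / n ≤ 1 / 100)
    (h2 : ∫ x, h x ^ 2 ∂p ≤ 1.3 * (0.45 / n * Real.log (1 / δ))) :
    HellingerClose n δ p (tilt p h) := by
  set s := Real.log (1 / δ) / n with hsdef
  have hd : hellingerSq p (tilt p h) ≤ 0.3 * s := by
    have e : 0.45 / n * Real.log (1 / δ) = 0.45 * s := by rw [hsdef]; ring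
    have h0 : 0 < s := by rw [hsdef]; exact div_pos (by linarith) hn
    rw [e] at h2
    linarith [H.hellingerSq_tilt_le]
  have h0 : 0 < s := div_pos (by linarith) hn
  refine ⟨by linarith, ?_⟩
  have hlog : Real.log (4 * δ) ≤ -0.9 * Real.log (1 / δ) := by
    have h4 : Real.log 4 ≤ 3 := by
      have := Real.log_le_sub_one_of_pos (show (0 : ℝ) < 4 by norm_num); linarith
    rw [Real.log_mul (by norm_num) hδ.ne']
    have : Real.log (1 / δ) = -Real.log δ := by rw [one_div, Real.log_inv]
    linarith
  have h1 : 1 / (2 * n) * Real.log (4 * δ) ≤ -0.45 * s := by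
    have := mul_le_mul_of_nonneg_left hlog (show 0 ≤ 1 / (2 * n) by positivity)
    refine this.trans (le_of_eq ?_)
    rw [hsdef]; field_simp; ring
  have hpos : 0 < 1 - hellingerSq p (tilt p h) := by linarith
  refine h1.trans ((?_ : _ ≤ 1 - (1 - hellingerSq p (tilt p h))⁻¹).trans
    (Real.one_sub_inv_le_log_of_pos hpos))
  have : (1 - hellingerSq p (tilt p h))⁻¹ ≤ 1 + 0.45 * s := by
    rw [inv_le_iff_one_le_mul₀ hpos]
    nlinarith
  linarith

/-! ### The error function in terms of the trimming level -/

/-- The error function, parametrized by the trimming level `t = 0.45 log (1 / δ) / n`. Dividing the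
sample size by three multiplies `t` by three. -/
def trimError (t : ℝ) (p : Measure ℝ) : ℝ :=
  |mean p - mean (trim p t)| + stdDev (trim p t) * √(10 * t)

theorem errorFn_eq_trimError (n δ : ℝ) (p : Measure ℝ) :
    errorFn n δ p = trimError (0.45 / n * Real.log (1 / δ)) p := by
  rw [errorFn, trimError, stdTrim]
  congr 3
  ring

/-- The data attached to a trimming: its radius, and the first two moments of `p` about its mean
over the trimming interval, in terms of the mean and variance of the trimmed distribution. -/
theorem exists_trim_moments (p : Measure ℝ) [IsProbabilityMeasure p] [NullSingletonClass p]
    {t : ℝ} (h0 : 0 < t) (h1 : t < 1) :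
    ∃ r, 0 ≤ r ∧ p.real (centered p r) = 1 - t ∧ p.real (centered p r)ᶜ = t ∧
      trim p t = cond p (centered p r) ∧
      ∫ x in centered p r, (x - mean p) ∂p = (1 - t) * (mean (trim p t) - mean p) ∧
      ∫ x in centered p r, (x - mean p) ^ 2 ∂p
        = (1 - t) * (stdDev (trim p t) ^ 2 + (mean (trim p t) - mean p) ^ 2) ∧
      0 < stdDev (trim p t) := by
  obtain ⟨r, hr⟩ := exists_isTrimRadius p h0 h1.le
  have hpos : 0 < p.real (centered p r) := by rw [hr.2]; linarith
  have hne : 1 - t ≠ 0 := by linarith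
  have hm := mean_cond_sub p hpos (mean p)
  have hv := variance_cond_eq p hpos (mean p)
  have hvp := variance_cond_pos p hpos
  change mean (cond p (centered p r)) - mean p
    = (p.real (centered p r))⁻¹ * ∫ x in centered p r, (x - mean p) ∂p at hm
  change Var[id; cond p (centered p r)]
      = (p.real (centered p r))⁻¹ * (∫ x in centered p r, (x - mean p) ^ 2 ∂p)
        - (mean (cond p (centered p r)) - mean p) ^ 2 at hv
  change 0 < Var[id; cond p (centered p r)] at hvp
  rw [hr.2] at hm hv
  refine ⟨r, hr.1, hr.2, ?_, trim_eq p hr, ?_, ?_, ?_⟩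
  · rw [probReal_compl_eq_one_sub (by exact measurableSet_Icc), hr.2]; ring
  · rw [trim_eq p hr, hm]; field_simp
  · rw [trim_eq p hr, stdDev, Real.sq_sqrt hvp.le, hv]; field_simp; ring
  · rw [trim_eq p hr, stdDev]; exact Real.sqrt_pos.2 hvp

theorem trimError_pos (p : Measure ℝ) [IsProbabilityMeasure p] [NullSingletonClass p]
    {t : ℝ} (h0 : 0 < t) (h1 : t < 1) : 0 < trimError t p := by
  obtain ⟨r, -, -, -, -, -, -, hs⟩ := exists_trim_moments p h0 h1
  have : 0 < √(10 * t) := Real.sqrt_pos.2 (by linarith)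
  have := mul_pos hs this
  have := abs_nonneg (mean p - mean (trim p t))
  unfold trimError
  linarith

/-! ### Truncated moments of a tilted distribution -/

theorem integrableOn_centered (p : Measure ℝ) [IsFiniteMeasure p] (m r : ℝ) {f : ℝ → ℝ}
    (hf : Continuous f) : Integrable ((Set.Icc (m - r) (m + r)).indicator f) p :=
  (integrable_indicator_iff measurableSet_Icc).2 hf.integrableOn_Icc

namespace IsTilt

variable {p : Measure ℝ} {h : ℝ → ℝ}

/-- If the tilted mass outside `I` is `3 t`, the mass outside `J` is `t`, and all points outside `I`
are at distance at least `u` from `c`, then `J` contains mass at least `t / 2` at distance at least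
`u` from `c`, so its second moment controls `u`. -/
theorem mul_sq_le_of_compl [IsProbabilityMeasure p] (H : IsTilt p h) {I J : Set ℝ}
    (hI : MeasurableSet I) (hJ : MeasurableSet J) {c t u : ℝ}
    (hJ2 : Integrable (J.indicator fun x => (x - c) ^ 2) p)
    (hJt : p.real Jᶜ = t) (hIt : ∫ x in Iᶜ, (1 + h x) ∂p = 3 * t)
    (hu : 0 ≤ u) (hIu : ∀ x ∉ I, u ≤ |x - c|) :
    t * u ^ 2 ≤ 2 * ∫ x in J, (x - c) ^ 2 ∂p := by
  have hg : Integrable (fun x => 1 + h x) p := (integrable_const 1).add H.integrable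
  have key : ∫ x, u ^ 2 * Iᶜ.indicator (fun x => 1 + h x) x ∂p
      ≤ ∫ x, (2 * u ^ 2 * Jᶜ.indicator (fun _ => (1 : ℝ)) x
        + 2 * J.indicator (fun x => (x - c) ^ 2) x) ∂p := by
    refine integral_mono ((hg.indicator hI.compl).const_mul _)
      ((((integrable_const 1).indicator hJ.compl).const_mul _).add (hJ2.const_mul _)) fun x => ?_
    have h1 := H.nonneg x
    have h2 := H.le_two x
    have hu2 := sq_nonneg u
    have hy := sq_nonneg (x - c)
    by_cases hxI : x ∈ I <;> by_cases hxJ : x ∈ J <;> simp [hxI, hxJ]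
    · exact hy
    · exact hu2
    · have h3 : u ^ 2 ≤ (x - c) ^ 2 := by
        rw [← sq_abs (x - c)]; exact pow_le_pow_left₀ hu (hIu x hxI) 2
      nlinarith
    · nlinarith
  rw [integral_const_mul, integral_indicator hI.compl, hIt, integral_add
    (((integrable_const 1).indicator hJ.compl).const_mul _) (hJ2.const_mul _),
    integral_const_mul, integral_const_mul, integral_indicator hJ.compl,
    integral_indicator hJ, setIntegral_const, hJt] at key
  simp only [smul_eq_mul, mul_one] at key
  linarith

/-- The density of the tilt is at most `2`, so the second moment over `I` at most doubles on `J`, and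
the rest of `I` has tilted mass at most `2 t`. -/
theorem setIntegral_sq_le [IsProbabilityMeasure p] (H : IsTilt p h) {I J : Set ℝ}
    (hI : MeasurableSet I) (hJ : MeasurableSet J) {c t B : ℝ}
    (hI2 : Integrable (I.indicator fun x => (x - c) ^ 2) p)
    (hJ2 : Integrable (J.indicator fun x => (x - c) ^ 2) p)
    (hJt : p.real Jᶜ = t) (hIB : ∀ x ∈ I, |x - c| ≤ B) :
    ∫ x in I, (x - c) ^ 2 ∂(tilt p h) ≤ 2 * (∫ x in J, (x - c) ^ 2 ∂p) + 2 * t * B ^ 2 := by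
  have hI2' := H.integrable_mul hI2
  have key : ∫ x, (I.indicator (fun x => (x - c) ^ 2) x
        + h x * I.indicator (fun x => (x - c) ^ 2) x) ∂p
      ≤ ∫ x, (2 * J.indicator (fun x => (x - c) ^ 2) x
        + 2 * B ^ 2 * Jᶜ.indicator (fun _ => (1 : ℝ)) x) ∂p := by
    refine integral_mono (hI2.add hI2')
      ((hJ2.const_mul _).add (((integrable_const 1).indicator hJ.compl).const_mul _)) fun x => ?_
    have h1 := H.nonneg x
    have h2 := H.le_two x
    have hy := sq_nonneg (x - c)
    have hB := sq_nonneg B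
    by_cases hxI : x ∈ I <;> by_cases hxJ : x ∈ J <;> simp [hxI, hxJ]
    · nlinarith
    · have h3 : (x - c) ^ 2 ≤ B ^ 2 := by
        rw [← sq_abs (x - c)]; exact pow_le_pow_left₀ (abs_nonneg _) (hIB x hxI) 2
      nlinarith
    · exact hy
    · exact hB
  rw [integral_add (hJ2.const_mul _) (((integrable_const 1).indicator hJ.compl).const_mul _),
    integral_const_mul, integral_const_mul, integral_indicator hJ.compl,
    integral_indicator hJ, setIntegral_const, hJt] at key
  simp only [smul_eq_mul, mul_one] at key
  rw [H.setIntegral_tilt hI, ← integral_indicator hI]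
  calc _ = _ := integral_congr_ae (ae_of_all _ fun x => ?_)
    _ ≤ _ := key
    _ = _ := by ring
  by_cases hxI : x ∈ I <;> simp [hxI]
  ring

/-- Comparison of truncated first moments before and after tilting. On `I ∩ J` the difference is
`h (x - c)`; on `J \ I` one uses `1 ≤ 4 / 3 * ((1 + h) + h ^ 2)`; both products are split by the
inequality of arithmetic and geometric means with parameter `α`. -/
theorem abs_setIntegral_sub_le [IsProbabilityMeasure p] (H : IsTilt p h) {I J : Set ℝ}
    (hI : MeasurableSet I) (hJ : MeasurableSet J) {c t B α : ℝ} (hα : 0 < α)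
    (hI1 : Integrable (I.indicator fun x => x - c) p)
    (hJ1 : Integrable (J.indicator fun x => x - c) p)
    (hJ2 : Integrable (J.indicator fun x => (x - c) ^ 2) p)
    (hJt : p.real Jᶜ = t) (hIt : ∫ x in Iᶜ, (1 + h x) ∂p = 3 * t)
    (hh : ∫ x, h x ^ 2 ∂p ≤ 1.3 * t) (hB : 0 ≤ B) (hIB : ∀ x ∈ I, |x - c| ≤ B) :
    |∫ x in I, (x - c) ∂(tilt p h) - ∫ x in J, (x - c) ∂p|
      ≤ α / 2 * (∫ x in J, (x - c) ^ 2 ∂p) + 2 / (3 * α) * (4.3 * t) + 2 * t * B := by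
  have hg : Integrable (fun x => 1 + h x) p := (integrable_const 1).add H.integrable
  have hI1' := H.integrable_mul hI1
  have hI12 : Integrable (fun x => I.indicator (fun x => x - c) x
      + h x * I.indicator (fun x => x - c) x) p := hI1.add hI1'
  have hG1 := hJ2.const_mul (α / 2)
  have hG2 : Integrable
      (fun x => 2 / (3 * α) * (h x ^ 2 + Iᶜ.indicator (fun x => 1 + h x) x)) p :=
    (H.integrable_sq.add (hg.indicator hI.compl)).const_mul (2 / (3 * α))
  have hG3 := (((integrable_const (1 : ℝ)).indicator hJ.compl).const_mul (2 * B) :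
    Integrable _ p)
  have hG12 : Integrable (fun x => α / 2 * J.indicator (fun x => (x - c) ^ 2) x
      + 2 / (3 * α) * (h x ^ 2 + Iᶜ.indicator (fun x => 1 + h x) x)) p := hG1.add hG2
  have e1 : ∫ x in I, (x - c) ∂(tilt p h) - ∫ x in J, (x - c) ∂p
      = ∫ x, (I.indicator (fun x => x - c) x + h x * I.indicator (fun x => x - c) x
        - J.indicator (fun x => x - c) x) ∂p := by
    rw [H.setIntegral_tilt hI, ← integral_indicator hI, ← integral_indicator hJ,
      integral_sub hI12 hJ1]
    congr 1
    refine integral_congr_ae (ae_of_all _ fun x => ?_)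
    by_cases hxI : x ∈ I <;> simp [hxI]
    ring
  have hmain := norm_integral_le_of_norm_le (μ := p) (hG12.add hG3)
    (f := fun x => I.indicator (fun x => x - c) x + h x * I.indicator (fun x => x - c) x
        - J.indicator (fun x => x - c) x) (ae_of_all _ fun x => ?_)
  · rw [e1, ← Real.norm_eq_abs]
    refine hmain.trans ?_
    simp only [Pi.add_apply]
    rw [integral_add hG12 hG3, integral_add hG1 hG2, integral_const_mul,
      integral_const_mul, integral_const_mul, integral_add H.integrable_sq
      (hg.indicator hI.compl), integral_indicator hI.compl, hIt, integral_indicator hJ,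
      integral_indicator hJ.compl, setIntegral_const, hJt]
    have : 2 / (3 * α) * ((∫ x, h x ^ 2 ∂p) + 3 * t) ≤ 2 / (3 * α) * (4.3 * t) :=
      mul_le_mul_of_nonneg_left (by linarith) (by positivity)
    simp only [smul_eq_mul, mul_one]
    linarith
  · have h1 := H.nonneg x
    have h2 := H.le_two x
    have hy := sq_nonneg (x - c)
    have hα' : α * (2 / (3 * α)) = 2 / 3 := by field_simp
    have hβ : 0 < 2 / (3 * α) := by positivity
    set β := 2 / (3 * α)
    have amgm : ∀ v : ℝ, 0 ≤ v → |x - c| * v ≤ α / 2 * (x - c) ^ 2 + 3 / 4 * β * v ^ 2 := by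
      intro v hv
      have : 0 ≤ α / 2 * (|x - c| - 3 / 2 * β * v) ^ 2 := by positivity
      have e := sq_abs (x - c)
      have e2 : α / 2 * (|x - c| - 3 / 2 * β * v) ^ 2
        = α / 2 * |x - c| ^ 2 - 3 / 2 * (α * β) * |x - c| * v
          + 9 / 8 * (α * β) * β * v ^ 2 := by ring
      rw [e2, hα', e] at this
      linarith
    rw [Real.norm_eq_abs]
    by_cases hxI : x ∈ I <;> by_cases hxJ : x ∈ J <;> simp [hxI, hxJ]
    · have := amgm |h x| (abs_nonneg _)
      rw [sq_abs] at this
      nlinarith [mul_nonneg hβ.le (sq_nonneg (h x))]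
    · have h3 : x - c + h x * (x - c) = (1 + h x) * (x - c) := by ring
      rw [h3, abs_mul, abs_of_nonneg h1]
      have := hIB x hxI
      have : (1 + h x) * |x - c| ≤ 2 * B :=
        mul_le_mul h2 this (abs_nonneg _) (by norm_num)
      have := mul_nonneg hβ.le (sq_nonneg (h x))
      linarith
    · have := amgm 1 zero_le_one
      rw [abs_sub_comm]
      have h4 : β * (3 / 4) ≤ β * (h x ^ 2 + (1 + h x)) :=
        mul_le_mul_of_nonneg_left (by nlinarith [sq_nonneg (h x + 1 / 2)]) hβ.le
      linarith
    · have h3 : 0 ≤ β * (h x ^ 2 + (1 + h x)) :=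
        mul_nonneg hβ.le (by nlinarith [sq_nonneg (h x)])
      linarith

end IsTilt

/-- The numerical part of the comparison of error functions: `b` and `σ` are the mean shift and
standard deviation of the trimmed distribution, `S` its unnormalized second moment, `d` the distance
between the two means, `ρ` the trimming radius of the tilted distribution, and `M`, `W` its trimmed
first moment and variance. -/
theorem error_bound_of_moments {t b σ S d ρ M W ε : ℝ} (ht : 0 < t) (ht' : t ≤ 1 / 2000)
    (hb : 0 ≤ b) (hσ : 0 ≤ σ) (hε : ε = b + σ * √(10 * t)) (hS0 : 0 < S)
    (hS : S = (1 - t) * (σ ^ 2 + b ^ 2)) (hd0 : 0 ≤ d) (hd : d ≤ ε) (hρ : 0 ≤ ρ)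
    (hρd : d ≤ ρ → t * (ρ - d) ^ 2 ≤ 2 * S)
    (hM : M ≤ (1 - t) * b + (√t / √S * S + √S / (3 * √t) * (4.3 * t) + 2 * t * (ρ + d)))
    (hW : W ≤ (1 - 3 * t)⁻¹ * (2 * S + 2 * t * (ρ + d) ^ 2)) :
    d + (1 - 3 * t)⁻¹ * M + √W * √(10 * (3 * t)) ≤ 100 * ε := by
  obtain ⟨τ, hτ⟩ : ∃ τ, τ = √t := ⟨_, rfl⟩
  obtain ⟨R, hR⟩ : ∃ R, R = √S := ⟨_, rfl⟩
  have hτ0 : 0 < τ := hτ ▸ Real.sqrt_pos.2 ht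
  have hR0 : 0 < R := hR ▸ Real.sqrt_pos.2 hS0
  have hτ2 : τ ^ 2 = t := hτ ▸ Real.sq_sqrt ht.le
  have hR2 : R ^ 2 = S := hR ▸ Real.sq_sqrt hS0.le
  have hτs : τ ≤ 1 / 40 := abs_le_of_sq_le_sq' (by rw [hτ2]; linarith) (by norm_num) |>.2
  rw [← hτ, ← hR] at hM
  have e1 : τ / R * S = τ * R := by rw [← hR2]; field_simp
  have e2 : R / (3 * τ) * (4.3 * t) = 4.3 / 3 * (τ * R) := by rw [← hτ2]; field_simp
  rw [e1, e2] at hM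
  have hε0 : 0 ≤ ε := hd0.trans hd
  have hbε : b ≤ ε := by
    have := mul_nonneg hσ (Real.sqrt_nonneg (10 * t)); linarith
  have hσε : τ * σ ≤ ε / 3 := by
    have h3 : 3 * τ ≤ √(10 * t) := Real.le_sqrt_of_sq_le (by nlinarith)
    nlinarith
  have hRle : R ≤ σ + b := abs_le_of_sq_le_sq'
    (by rw [hR2, hS]; nlinarith [mul_nonneg hσ hb, sq_nonneg σ, sq_nonneg b]) (by positivity) |>.2
  have hτb : τ * b ≤ 1 / 40 * ε := mul_le_mul hτs hbε hb (by norm_num)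
  have hX : τ * R ≤ 0.36 * ε := by
    have := mul_le_mul_of_nonneg_left hRle hτ0.le
    linarith
  have hP : τ * (ρ + d) ≤ 1.5 * R + 2 * (τ * d) := by
    rcases le_total d ρ with hle | hle
    · have h4 := hρd hle
      have : τ * (ρ - d) ≤ 1.5 * R := abs_le_of_sq_le_sq'
        (by rw [mul_pow, hτ2, mul_pow, hR2]; linarith) (by positivity) |>.2
      linarith
    · have := mul_le_mul_of_nonneg_left hle hτ0.le
      linarith
  have hτd : τ * d ≤ 1 / 40 * ε := mul_le_mul hτs hd hd0 (by norm_num)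
  have hQ0 : 0 ≤ τ * (τ * (ρ + d)) := by positivity
  have hQ : τ * (τ * (ρ + d)) ≤ 0.6 * ε := by
    have h1 := mul_le_mul_of_nonneg_left hP hτ0.le
    have h2 : τ * (τ * d) ≤ 1 / 40 * (1 / 40 * ε) :=
      mul_le_mul hτs hτd (by positivity) (by norm_num)
    linarith
  have e3 : 2 * t * (ρ + d) = 2 * (τ * (τ * (ρ + d))) := by rw [← hτ2]; ring
  have hM' : M ≤ 3.1 * ε := by
    have : (1 - t) * b ≤ ε := by nlinarith
    linarith
  have hinv : (1 - 3 * t)⁻¹ ≤ 1.1 := by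
    rw [inv_le_iff_one_le_mul₀ (by linarith)]; linarith
  have hinv0 : 0 < (1 - 3 * t)⁻¹ := inv_pos.2 (by linarith)
  have hM'' : (1 - 3 * t)⁻¹ * M ≤ 3.5 * ε := by
    have h1 := mul_le_mul_of_nonneg_left hM' hinv0.le
    have h2 := mul_le_mul_of_nonneg_right hinv (by positivity : 0 ≤ 3.1 * ε)
    linarith
  have hsd : √W * √(10 * (3 * t)) ≤ 6 * ε := by
    rw [← Real.sqrt_mul' _ (by positivity)]
    refine Real.sqrt_le_iff.2 ⟨by positivity, ?_⟩
    have hA : 0 ≤ 2 * S + 2 * t * (ρ + d) ^ 2 := by positivity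
    have h5 : W ≤ 1.1 * (2 * S + 2 * t * (ρ + d) ^ 2) :=
      hW.trans (mul_le_mul_of_nonneg_right hinv hA)
    have h6 : W * (10 * (3 * t)) ≤ 1.1 * (2 * S + 2 * t * (ρ + d) ^ 2) * (10 * (3 * t)) :=
      mul_le_mul_of_nonneg_right h5 (by positivity)
    have e4 : 1.1 * (2 * S + 2 * t * (ρ + d) ^ 2) * (10 * (3 * t))
        = 66 * (τ * R) ^ 2 + 66 * (τ * (τ * (ρ + d))) ^ 2 := by
      rw [← hτ2, ← hR2]; ring
    have h7 : (τ * R) ^ 2 ≤ (0.36 * ε) ^ 2 := pow_le_pow_left₀ (by positivity) hX 2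
    have h8 : (τ * (τ * (ρ + d))) ^ 2 ≤ (0.6 * ε) ^ 2 := pow_le_pow_left₀ hQ0 hQ 2
    refine h6.trans (e4.trans_le ?_)
    nlinarith only [h7, h8, sq_nonneg ε]
  linarith

/-- Tilting by a perturbation of small `χ²`-size that moves the mean by at most the error of `p`
increases the error by at most a constant factor, even at three times the trimming level. -/
theorem IsTilt.trimError_le {p : Measure ℝ} [IsProbabilityMeasure p] [NullSingletonClass p]
    {h : ℝ → ℝ} (H : IsTilt p h) {t : ℝ} (ht : 0 < t) (ht' : t ≤ 1 / 2000)
    (hh : ∫ x, h x ^ 2 ∂p ≤ 1.3 * t) (hd : |mean (tilt p h) - mean p| ≤ trimError t p) :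
    trimError (3 * t) (tilt p h) ≤ 100 * trimError t p := by
  have := H.isProbabilityMeasure_tilt
  have : NullSingletonClass (tilt p h) :=
    ⟨fun x => tilt_absolutelyContinuous (measure_singleton (μ := p) x)⟩
  obtain ⟨r, -, hr, hJt, htr, hJ1, hJ2, hσ⟩ := exists_trim_moments p ht (by linarith)
  obtain ⟨ρ, hρ⟩ := exists_isTrimRadius (tilt p h) (t := 3 * t) (by linarith) (by linarith)
  set q := tilt p h
  set μ := mean p with hμ
  set d := |mean q - μ| with hddef
  have hJm : MeasurableSet (centered p r) := measurableSet_Icc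
  have hIm : MeasurableSet (centered q ρ) := measurableSet_Icc
  have hqpos : 0 < q.real (centered q ρ) := by rw [hρ.2]; linarith
  have hIt : ∫ x in (centered q ρ)ᶜ, (1 + h x) ∂p = 3 * t := by
    rw [← H.measureReal_tilt hIm.compl, probReal_compl_eq_one_sub hIm, hρ.2]; ring
  have hIB : ∀ x ∈ centered q ρ, |x - μ| ≤ ρ + d := by
    intro x hx
    have h1 : |x - mean q| ≤ ρ := abs_le.2 ⟨by linarith [hx.1], by linarith [hx.2]⟩
    have := abs_sub_le x (mean q) μ
    linarith
  have hIu : ∀ x ∉ centered q ρ, ρ - d ≤ |x - μ| := by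
    intro x hx
    have h1 : ρ < |x - mean q| := by
      by_contra hcon
      have := abs_le.1 (not_lt.1 hcon)
      exact hx ⟨by linarith, by linarith⟩
    have := abs_sub_le x μ (mean q)
    rw [abs_sub_comm μ] at this
    linarith
  set S := ∫ x in centered p r, (x - μ) ^ 2 ∂p with hSdef
  set σ := stdDev (trim p t) with hσdef
  have hS0 : 0 < S := by
    rw [hJ2]; exact mul_pos (by linarith) (by positivity)
  have iJ2 := integrableOn_centered p (mean p) r (f := fun x => (x - μ) ^ 2) (by fun_prop)
  have iJ1 := integrableOn_centered p (mean p) r (f := fun x => x - μ) (by fun_prop)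
  have iI2 := integrableOn_centered p (mean q) ρ (f := fun x => (x - μ) ^ 2) (by fun_prop)
  have iI1 := integrableOn_centered p (mean q) ρ (f := fun x => x - μ) (by fun_prop)
  have hρd : d ≤ ρ → t * (ρ - d) ^ 2 ≤ 2 * S := fun hle =>
    H.mul_sq_le_of_compl hIm hJm iJ2 hJt hIt (by linarith) hIu
  have hW := H.setIntegral_sq_le hIm hJm iI2 iJ2 hJt hIB
  have hτ0 : 0 < √t := Real.sqrt_pos.2 ht
  have hR0 : 0 < √S := Real.sqrt_pos.2 hS0
  have hd0 : 0 ≤ d := abs_nonneg _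
  -- the parameter balances the two terms produced by the arithmetic-geometric mean inequality
  have hM := H.abs_setIntegral_sub_le hIm hJm (α := 2 * √t / √S) (by positivity) iI1 iJ1 iJ2 hJt
    hIt hh (add_nonneg hρ.1 hd0) hIB
  have hmq := mean_cond_sub q hqpos μ
  have hvq := variance_cond_eq q hqpos μ
  change mean (cond q (centered q ρ)) - μ
    = (q.real (centered q ρ))⁻¹ * ∫ x in centered q ρ, (x - μ) ∂q at hmq
  change Var[id; cond q (centered q ρ)]
      = (q.real (centered q ρ))⁻¹ * (∫ x in centered q ρ, (x - μ) ^ 2 ∂q)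
        - (mean (cond q (centered q ρ)) - μ) ^ 2 at hvq
  rw [hρ.2] at hmq hvq
  have hinv0 : 0 < (1 - 3 * t)⁻¹ := inv_pos.2 (by linarith)
  have hb : |mean p - mean (trim p t)| = |mean (trim p t) - μ| := abs_sub_comm _ _
  set M := ∫ x in centered q ρ, (x - μ) ∂q
  have hMle : |M| ≤ (1 - t) * |mean (trim p t) - μ|
      + (√t / √S * S + √S / (3 * √t) * (4.3 * t) + 2 * t * (ρ + d)) := by
    rw [hJ1] at hM
    have h1 : |M| ≤ |M - (1 - t) * (mean (trim p t) - μ)| + |(1 - t) * (mean (trim p t) - μ)| := by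
      have := abs_add_le (M - (1 - t) * (mean (trim p t) - μ)) ((1 - t) * (mean (trim p t) - μ))
      simpa using this
    rw [abs_mul (1 - t), abs_of_pos (by linarith : 0 < 1 - t)] at h1
    have e1 : 2 * √t / √S / 2 = √t / √S := by ring
    have e2 : 2 / (3 * (2 * √t / √S)) = √S / (3 * √t) := by field_simp
    rw [e1, e2] at hM
    linarith
  have hWle : Var[id; cond q (centered q ρ)]
      ≤ (1 - 3 * t)⁻¹ * (2 * S + 2 * t * (ρ + d) ^ 2) := by
    rw [hvq]
    have := mul_le_mul_of_nonneg_left hW hinv0.le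
    have := sq_nonneg (mean (cond q (centered q ρ)) - μ)
    linarith
  have hfin := error_bound_of_moments ht ht' (abs_nonneg (mean (trim p t) - μ)) hσ.le
    (ε := trimError t p) (by rw [trimError, hb]) hS0 (by rw [hJ2, sq_abs]) hd0 hd hρ.1 hρd hMle hWle
  refine le_trans ?_ hfin
  rw [trimError, trim_eq q hρ, stdDev]
  have h2 : |mean q - mean (cond q (centered q ρ))| ≤ d + (1 - 3 * t)⁻¹ * |M| := by
    have := abs_sub_le (mean q) μ (mean (cond q (centered q ρ)))
    rw [abs_sub_comm μ, hmq, abs_mul, abs_of_pos hinv0] at this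
    exact this
  linarith

/-! ### Tilts that move the mean -/

/-- A function of oscillation at most one and small second moment gives, after centering and
scaling, a perturbation moving the mean by any prescribed amount up to the covariance of the
function with the identity. -/
theorem exists_isTilt_of_function {p : Measure ℝ} [IsProbabilityMeasure p]
    (hp : Integrable (fun x : ℝ => x) p) {f : ℝ → ℝ} (hf : Measurable f) {a : ℝ}
    (hfa : ∀ x, f x ∈ Set.Icc a (a + 1)) {s e : ℝ} (hfs : ∫ x, f x ^ 2 ∂p ≤ s) (he : 0 < e)
    (hfe : e ≤ |∫ x, (x - mean p) * f x ∂p|) :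
    ∃ h, IsTilt p h ∧ ∫ x, h x ^ 2 ∂p ≤ s ∧ |∫ x, h x * x ∂p| = e := by
  have hbd : ∀ x, ‖f x‖ ≤ |a| + 1 := fun x => by
    rw [Real.norm_eq_abs, abs_le]
    have h1 := (hfa x).1
    have h2 := (hfa x).2
    constructor <;> linarith [neg_abs_le a, le_abs_self a]
  have hmul : ∀ {g : ℝ → ℝ}, Integrable g p → Integrable (fun x => f x * g x) p := fun hg =>
    hg.bdd_mul hf.aestronglyMeasurable (ae_of_all _ hbd)
  have hfi : Integrable f p := by simpa using hmul (integrable_const (1 : ℝ))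
  have hfi2 : Integrable (fun x => f x ^ 2) p := by simpa [sq] using hmul hfi
  set m := ∫ x, f x ∂p with hm
  have hma : a ≤ m := by
    have := integral_mono (integrable_const a) hfi fun x => (hfa x).1
    simpa using this
  have hmb : m ≤ a + 1 := by
    have := integral_mono hfi (integrable_const (a + 1)) fun x => (hfa x).2
    simpa using this
  set K := ∫ x, (x - mean p) * f x ∂p with hK
  have hK0 : 0 < |K| := he.trans_le hfe
  set l := e / |K| with hl
  have hl0 : 0 ≤ l := by positivity
  have hl1 : l ≤ 1 := div_le_one_of_le₀ hfe hK0.le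
  have hKeq : K = ∫ x, (f x - m) * x ∂p := by
    have e1 : K = ∫ x, (f x * x - mean p * f x) ∂p := by
      rw [hK]; congr 1; ext x; ring
    have e2 : ∫ x, (f x - m) * x ∂p = ∫ x, (f x * x - m * x) ∂p := by
      congr 1; ext x; ring
    rw [e1, e2, integral_sub (hmul hp) (hfi.const_mul _), integral_sub (hmul hp) (hp.const_mul _),
      integral_const_mul, integral_const_mul, mean]
    ring
  refine ⟨fun x => l * (f x - m), ⟨(hf.sub_const m).const_mul l, fun x => ?_, ?_⟩, ?_, ?_⟩
  · rw [abs_mul, abs_of_nonneg hl0]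
    have : |f x - m| ≤ 1 := by
      rw [abs_le]; constructor <;> linarith [(hfa x).1, (hfa x).2]
    exact mul_le_one₀ hl1 (abs_nonneg _) this
  · rw [integral_const_mul, integral_sub hfi (integrable_const m), integral_const]
    simp [← hm]
  · have e1 : ∫ x, (l * (f x - m)) ^ 2 ∂p = l ^ 2 * ((∫ x, f x ^ 2 ∂p) - m ^ 2) := by
      have e2 : (fun x => (l * (f x - m)) ^ 2)
          = fun x => l ^ 2 * (f x ^ 2 - (2 * m * f x - m ^ 2)) := by ext x; ring
      have hi : Integrable (fun x => 2 * m * f x - m ^ 2) p :=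
        (hfi.const_mul _).sub (integrable_const _)
      rw [e2, integral_const_mul, integral_sub hfi2 hi,
        integral_sub (hfi.const_mul _) (integrable_const _), integral_const_mul, integral_const]
      simp [← hm]
      left; ring
    have h2 : 0 ≤ ∫ x, f x ^ 2 ∂p := integral_nonneg fun x => sq_nonneg _
    rw [e1]
    have h3 : l ^ 2 ≤ 1 := pow_le_one₀ hl0 hl1
    nlinarith [mul_nonneg (sq_nonneg l) (sq_nonneg m)]
  · have e1 : ∫ x, l * (f x - m) * x ∂p = l * K := by
      rw [hKeq, ← integral_const_mul]; congr 1; ext x; ring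
    rw [e1, abs_mul, abs_of_nonneg hl0, hl, div_mul_cancel₀ _ hK0.ne']

/-- Truncation of a real number to `[-1 / 2, 1 / 2]`. -/
def clip (u : ℝ) : ℝ := max (-(1 / 2)) (min (1 / 2) u)

theorem clip_mem (u : ℝ) : clip u ∈ Set.Icc (-(1 / 2)) (-(1 / 2) + 1 : ℝ) :=
  ⟨le_max_left _ _, max_le (by norm_num) ((min_le_left _ _).trans (by norm_num))⟩

theorem clip_of_abs_le {u : ℝ} (hu : |u| ≤ 1 / 2) : clip u = u := by
  rw [abs_le] at hu
  rw [clip, min_eq_right hu.2, max_eq_right hu.1]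

theorem mul_clip_of_le_abs {u : ℝ} (hu : 1 / 2 ≤ |u|) : u * clip u = |u| / 2 := by
  rcases le_abs.1 hu with h | h
  · rw [clip, min_eq_left h, max_eq_right (by norm_num), abs_of_nonneg (by linarith)]; ring
  · rw [clip, min_eq_right (by linarith), max_eq_left (by linarith), abs_of_nonpos (by linarith)]
    ring

theorem mul_clip_nonneg (u : ℝ) : 0 ≤ u * clip u := by
  rcases le_total |u| (1 / 2) with h | h
  · rw [clip_of_abs_le h]; exact mul_self_nonneg u
  · rw [mul_clip_of_le_abs h]; positivity

theorem clip_sq_le_quarter (u : ℝ) : clip u ^ 2 ≤ 1 / 4 := by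
  have := clip_mem u
  nlinarith [this.1, this.2]

theorem clip_sq_le_sq (u : ℝ) : clip u ^ 2 ≤ u ^ 2 := by
  rcases le_total |u| (1 / 2) with h | h
  · rw [clip_of_abs_le h]
  · have := pow_le_pow_left₀ (by norm_num) h 2
    rw [sq_abs] at this
    linarith [clip_sq_le_quarter u]

/-- The deviation of `x` from the mean, rescaled by `a > 0` and clipped, has a large covariance with
`x`: either the clipping level is not reached on the interval of radius `r`, and the interval alone
contributes `a` times its second moment, or all of the mass outside is clipped and contributes at
least `1 / (4 a)` per unit. -/
theorem le_integral_mul_clip {p : Measure ℝ} [IsProbabilityMeasure p]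
    (hp : Integrable (fun x : ℝ => x) p) {a r : ℝ} (ha : 0 < a) :
    min (a * ∫ x in centered p r, (x - mean p) ^ 2 ∂p) (p.real (centered p r)ᶜ / (4 * a))
      ≤ ∫ x, (x - mean p) * clip (a * (x - mean p)) ∂p := by
  have hJ : MeasurableSet (centered p r) := measurableSet_Icc
  have hcont : Continuous fun x => clip (a * (x - mean p)) := by unfold clip; fun_prop
  have hint : Integrable (fun x => (x - mean p) * clip (a * (x - mean p))) p := by
    simp only [mul_comm (_ - mean p) (clip _)]
    refine (hp.sub (integrable_const _)).bdd_mul (c := 1) hcont.aestronglyMeasurable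
      (ae_of_all _ fun x => ?_)
    have := clip_mem (a * (x - mean p))
    rw [Real.norm_eq_abs, abs_le]
    constructor <;> linarith [this.1, this.2]
  have hnn : ∀ y, 0 ≤ y * clip (a * y) := fun y => by
    have := mul_clip_nonneg (a * y)
    rw [mul_assoc] at this
    exact nonneg_of_mul_nonneg_right this ha
  have hmem : ∀ x, x ∈ centered p r ↔ |x - mean p| ≤ r := fun x => by
    rw [abs_le, centered, Set.mem_Icc]
    constructor <;> rintro ⟨h1, h2⟩ <;> constructor <;> linarith
  rcases le_total (a * r) (1 / 2) with har | har
  · refine (min_le_left _ _).trans ?_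
    rw [← integral_const_mul, ← integral_indicator hJ]
    refine integral_mono (integrableOn_centered p _ _ (by fun_prop)) hint fun x => ?_
    by_cases hx : x ∈ centered p r
    · simp only [hx, Set.indicator_of_mem]
      rw [clip_of_abs_le]
      · exact le_of_eq (by ring)
      · rw [abs_mul, abs_of_pos ha]
        exact (mul_le_mul_of_nonneg_left ((hmem x).1 hx) ha.le).trans har
    · simpa [hx] using hnn (x - mean p)
  · refine (min_le_right _ _).trans ?_
    have e1 : p.real (centered p r)ᶜ / (4 * a)
        = ∫ x, (centered p r)ᶜ.indicator (fun _ => 1 / (4 * a)) x ∂p := by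
      rw [integral_indicator hJ.compl, setIntegral_const, smul_eq_mul]; ring
    rw [e1]
    refine integral_mono ((integrable_const _).indicator hJ.compl) hint fun x => ?_
    by_cases hx : x ∈ centered p r
    · simpa [hx] using hnn (x - mean p)
    · have hx' : r < |x - mean p| := not_le.1 fun h => hx ((hmem x).2 h)
      have h1 : 1 / 2 ≤ a * |x - mean p| := har.trans (mul_le_mul_of_nonneg_left hx'.le ha.le)
      have h2 := mul_clip_of_le_abs (u := a * (x - mean p)) (by rwa [abs_mul, abs_of_pos ha])
      rw [abs_mul, abs_of_pos ha] at h2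
      have h3 : (x - mean p) * clip (a * (x - mean p)) = |x - mean p| / 2 := by
        have h4 : a * ((x - mean p) * clip (a * (x - mean p))) = a * (|x - mean p| / 2) := by
          linarith
        exact mul_left_cancel₀ ha.ne' h4
      simp only [Set.mem_compl_iff, hx, not_false_eq_true, Set.indicator_of_mem]
      rw [h3, div_le_div_iff₀ (by positivity) (by norm_num)]
      linarith

theorem integral_clip_sq_le {p : Measure ℝ} [IsProbabilityMeasure p] (a r : ℝ) :
    ∫ x, clip (a * (x - mean p)) ^ 2 ∂p
      ≤ a ^ 2 * (∫ x in centered p r, (x - mean p) ^ 2 ∂p) + 1 / 4 * p.real (centered p r)ᶜ := by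
  have hJ : MeasurableSet (centered p r) := measurableSet_Icc
  have h1 := (integrableOn_centered p (mean p) r (f := fun x => (x - mean p) ^ 2)
    (by fun_prop)).const_mul (a ^ 2)
  have h2 := ((integrable_const (1 / 4 : ℝ)).indicator hJ.compl : Integrable _ p)
  have key := integral_mono_of_nonneg (μ := p) (f := fun x => clip (a * (x - mean p)) ^ 2)
    (ae_of_all _ fun x => sq_nonneg _) (h1.add h2) (ae_of_all _ fun x => ?_)
  · simp only [Pi.add_apply] at key
    rw [integral_add h1 h2, integral_const_mul, integral_indicator hJ.compl, setIntegral_const,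
      integral_indicator measurableSet_Icc] at key
    rw [smul_eq_mul, mul_comm (p.real _)] at key
    exact key
  · by_cases hx : x ∈ centered p r
    · have hx' : x ∈ Set.Icc (mean p - r) (mean p + r) := hx
      simp only [Pi.add_apply, Set.indicator_of_mem hx', Set.mem_compl_iff, hx, not_true,
        not_false_eq_true, Set.indicator_of_notMem, add_zero]
      rw [← mul_pow]
      exact clip_sq_le_sq _
    · have hx' : x ∉ Set.Icc (mean p - r) (mean p + r) := hx
      simp only [Pi.add_apply, Set.indicator_of_notMem hx', Set.mem_compl_iff, hx,
        not_false_eq_true, Set.indicator_of_mem, mul_zero, zero_add]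
      exact clip_sq_le_quarter _

/-- Some tilt of `χ²`-size at most `1.3 t` moves the mean by exactly `1 / 32` of the error. -/
theorem exists_isTilt_mean_shift {p : Measure ℝ} [IsProbabilityMeasure p] [NullSingletonClass p]
    (hp : Integrable (fun x : ℝ => x) p) {t : ℝ} (ht : 0 < t) (ht' : t ≤ 1 / 2000) :
    ∃ h, IsTilt p h ∧ ∫ x, h x ^ 2 ∂p ≤ 1.3 * t ∧
      |mean (tilt p h) - mean p| = trimError t p / 32 := by
  have hε0 : 0 < trimError t p := trimError_pos p ht (by linarith)
  obtain ⟨r, -, -, hJt, -, hJ1, hJ2, hσ⟩ := exists_trim_moments p ht (by linarith)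
  have hJ : MeasurableSet (centered p r) := measurableSet_Icc
  suffices h : ∃ f : ℝ → ℝ, ∃ a : ℝ, Measurable f ∧ (∀ x, f x ∈ Set.Icc a (a + 1)) ∧
      ∫ x, f x ^ 2 ∂p ≤ 1.3 * t ∧ trimError t p / 32 ≤ |∫ x, (x - mean p) * f x ∂p| by
    obtain ⟨f, a, hf, hfa, hfs, hfe⟩ := h
    obtain ⟨h, H, hh, he⟩ := exists_isTilt_of_function hp hf hfa hfs (by linarith) hfe
    exact ⟨h, H, hh, by rw [H.mean_tilt_sub hp, he]⟩
  set σ := stdDev (trim p t)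
  have hεdef : trimError t p = |mean (trim p t) - mean p| + σ * √(10 * t) := by
    rw [trimError, abs_sub_comm]
  set b := mean (trim p t) - mean p
  rcases le_or_gt (trimError t p / 31) |b| with hb | hb
  · -- the mean shift dominates: change the weight of the mass outside the trimming interval
    refine ⟨(centered p r)ᶜ.indicator fun _ => 1, 0, measurable_const.indicator hJ.compl,
      fun x => ?_, ?_, ?_⟩
    · by_cases hx : x ∈ centered p r <;> simp [hx]
    · have : ∀ x, (centered p r)ᶜ.indicator (fun _ => (1 : ℝ)) x ^ 2
          = (centered p r)ᶜ.indicator (fun _ => 1) x := fun x => by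
        by_cases hx : x ∈ centered p r <;> simp [hx]
      simp only [this]
      rw [integral_indicator hJ.compl, setIntegral_const, hJt, smul_eq_mul]
      linarith
    · have hi : Integrable (fun x => x - mean p) p := hp.sub (integrable_const _)
      have e1 : ∫ x, (x - mean p) * (centered p r)ᶜ.indicator (fun _ => (1 : ℝ)) x ∂p
          = ∫ x in (centered p r)ᶜ, (x - mean p) ∂p := by
        rw [← integral_indicator hJ.compl]
        congr 1; ext x
        by_cases hx : x ∈ centered p r <;> simp [hx]
      have e2 : ∫ x, (x - mean p) ∂p = 0 := by
        rw [integral_sub hp (integrable_const _), integral_const]; simp [mean]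
      have e3 := integral_add_compl hJ hi
      rw [e1, show ∫ x in (centered p r)ᶜ, (x - mean p) ∂p = -((1 - t) * b) by linarith, abs_neg,
        abs_mul, abs_of_pos (by linarith)]
      nlinarith
  · -- the deviation dominates: with the slope `√t / σ` the interval contributes about `t` to `∫ f²`
    obtain ⟨τ, hτ⟩ : ∃ τ, τ = √t := ⟨_, rfl⟩
    have hτ0 : 0 < τ := hτ ▸ Real.sqrt_pos.2 ht
    have hτ2 : τ ^ 2 = t := hτ ▸ Real.sq_sqrt ht.le
    have hs1 : √(10 * t) ≤ 3.2 * τ := Real.sqrt_le_iff.2 ⟨by positivity, by nlinarith⟩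
    have hs2 : √(10 * t) ≤ 1 := Real.sqrt_le_one.2 (by linarith)
    have h1 : σ * √(10 * t) ≤ σ * (3.2 * τ) := mul_le_mul_of_nonneg_left hs1 hσ.le
    have h2 : σ * √(10 * t) ≤ σ * 1 := mul_le_mul_of_nonneg_left hs2 hσ.le
    have hε : trimError t p ≤ 4 * (τ * σ) := by nlinarith [mul_pos hτ0 hσ]
    have hbσ : |b| ≤ σ / 30 := by linarith
    have hb2 : b ^ 2 ≤ (σ / 30) ^ 2 := by
      rw [← sq_abs b]; exact pow_le_pow_left₀ (abs_nonneg _) hbσ 2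
    have ha : 0 < τ / σ := by positivity
    refine ⟨fun x => clip (τ / σ * (x - mean p)), -(1 / 2), ?_, fun x => clip_mem _, ?_, ?_⟩
    · unfold clip; fun_prop
    · refine (integral_clip_sq_le _ r).trans ?_
      rw [hJt, hJ2, div_pow, hτ2]
      have h3 : t / σ ^ 2 * ((1 - t) * (σ ^ 2 + b ^ 2)) ≤ t / σ ^ 2 * (1.01 * σ ^ 2) :=
        mul_le_mul_of_nonneg_left (by nlinarith [sq_nonneg b, sq_nonneg σ]) (by positivity)
      have h4 : t / σ ^ 2 * (1.01 * σ ^ 2) = 1.01 * t := by field_simp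
      linarith
    · have h3 := le_integral_mul_clip hp (r := r) ha
      refine le_trans ?_ (h3.trans (le_abs_self _))
      have hτσ : 0 < τ * σ := by positivity
      rw [hJt, hJ2]
      refine le_min ?_ ?_
      · have h4 : τ / σ * (1 / 2 * σ ^ 2) ≤ τ / σ * ((1 - t) * (σ ^ 2 + b ^ 2)) :=
          mul_le_mul_of_nonneg_left (by nlinarith [sq_nonneg b, sq_nonneg σ]) ha.le
        have h5 : τ / σ * (1 / 2 * σ ^ 2) = 1 / 2 * (τ * σ) := by field_simp
        linarith
      · have h5 : t / (4 * (τ / σ)) = 1 / 4 * (τ * σ) := by rw [← hτ2]; field_simp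
        rw [h5]; linarith

end

end MeanEst

theorem mainTheorem4 :
    ∃ c : ℝ, 0 < c ∧
      ∀ (n : ℕ) (δ : ℝ), 0 < n → 0 < δ → δ ≤ c → Real.log (1 / δ) / (n : ℝ) ≤ c →
        ∀ p : MeasureTheory.Measure ℝ, p ∈ MeanEst.FiniteMeanDist → (∀ x : ℝ, p {x} = 0) →
          ∃ q : MeasureTheory.Measure ℝ, q ≠ p ∧
            MeanEst.errorFn n δ p / 32 ≤ |MeanEst.mean q - MeanEst.mean p| ∧
            MeanEst.HellingerClose n δ p q ∧
            q ∈ MeanEst.nbhd n δ p := by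
  refine ⟨Real.exp (-1000), Real.exp_pos _, fun n δ hn hδ hδc hs p ⟨hprob, hint⟩ hatom => ?_⟩
  have : MeasureTheory.NullSingletonClass p := ⟨hatom⟩
  have hn' : (0 : ℝ) < n := Nat.cast_pos.2 hn
  have hL : 1000 ≤ Real.log (1 / δ) := by
    have := Real.log_le_log hδ hδc
    rw [Real.log_exp] at this
    rw [one_div, Real.log_inv]; linarith
  have hc : Real.exp (-1000) ≤ 1 / 1000 := by
    rw [Real.exp_neg, ← one_div]
    exact one_div_le_one_div_of_le (by norm_num) (by linarith [Real.add_one_le_exp (1000 : ℝ)])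
  have et : 0.45 / (n : ℝ) * Real.log (1 / δ) = 0.45 * (Real.log (1 / δ) / n) := by ring
  have et3 : 0.45 / ((n : ℝ) / 3) * Real.log (1 / δ)
      = 3 * (0.45 / (n : ℝ) * Real.log (1 / δ)) := by field_simp
  have hs0 : 0 < Real.log (1 / δ) / n := div_pos (by linarith) hn'
  have ht : 0 < 0.45 / (n : ℝ) * Real.log (1 / δ) := by rw [et]; positivity
  have ht' : 0.45 / (n : ℝ) * Real.log (1 / δ) ≤ 1 / 2000 := by rw [et]; linarith
  obtain ⟨h, H, hh, hd⟩ := MeanEst.exists_isTilt_mean_shift hint ht ht'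
  have hε := MeanEst.trimError_pos p ht (by linarith)
  have hclose := H.hellingerClose hn' hδ (by linarith) (by linarith) hh
  have hdle : |MeanEst.mean (MeanEst.tilt p h) - MeanEst.mean p|
      ≤ MeanEst.trimError (0.45 / (n : ℝ) * Real.log (1 / δ)) p := by linarith
  refine ⟨MeanEst.tilt p h, fun heq => ?_, ?_, hclose,
    ⟨H.isProbabilityMeasure_tilt, H.integrable_tilt hint⟩, ?_, hclose, ?_, H.densityLeTwo_tilt⟩
  · rw [heq, sub_self, abs_zero] at hd
    linarith
  · rw [MeanEst.errorFn_eq_trimError, hd]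
  · rw [MeanEst.errorFn_eq_trimError, MeanEst.errorFn_eq_trimError, et3]
    exact H.trimError_le ht ht' hh hdle
  · rwa [MeanEst.errorFn_eq_trimError]
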